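/- A DAG task $\tau$ is a finite directed acyclic graph whose vertices $v$ have worst-case execution times $c(v)\ge 0$, together with a period $T$ (minimal separation of consecutive releases) and a relative deadline $D\le T$. A vertex of a job (release) can execute only after all its predecessors in the same job are finished. Let $C=\sum_v c(v)$, let $L$ be the largest total $c$-weight of a directed path, assume $L<D\le C$ (which covers every heavy task, $C/D>1$, with $L<D$), and put $\gamma=\frac{C-L}{D-L}$. The task is executed through containers $\varphi_1,\dots,\varphi_m$ with load bounds $\delta_1\ge\dots\ge\delta_m$; a container with load bound $0$ is never used. Whenever, at a time $t$, there are an eligible vertex (released, not finished, no part of it currently being executed, all predecessors in the same job finished) and an empty container with positive load bound, an arbitrary eligible vertex $v$, of which an amount $c$ of worst-case execution time is still to be dispatched, is assigned to an empty container $\varphi_p$ with the largest load bound. Let $d'$ be the earliest deadline of the occupied containers with load bound strictly larger than $\delta_p$ ($d'=\infty$ if there are none). If $d'>t+c/\delta_p$, then $\varphi_p$ receives all of this amount with absolute deadline $d_p=t+c/\delta_p$; otherwise it receives only an amount $(d'-t)\delta_p$, with $d_p=d'$, and the remaining amount $c-(d'-t)\delta_p$ is dispatched later, after the first part has finished. A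 container is occupied until its absolute deadline. If completions, dispatching and a release fall on the same instant, the release comes last. Every container is assumed to finish each part assigned to it no later than the corresponding absolute deadline. The task is called schedulable on the containers if in every such execution each job is finished no later than $D$ time units after its release. Put $S_x=\sum_{j\le x}\delta_j$ and $\lambda=\max_{x:\,\delta_x>0}\frac{S_m-S_x}{\delta_x}$. Then $\tau$ is schedulable on $\lfloor\gamma\rfloor$ containers with load bound $1$ plus one container with load bound $\gamma-\lfloor\gamma\rfloor$. For this configuration $\lambda=\gamma-1$, $S_m=\gamma$, and $$\frac{C+\lambda L}{S_m}=D .$$ -/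

import Mathlib

/-- A sporadic DAG task with vertex set `V`: a directed acyclic graph `G`, a worst-case execution
time `c v` for every vertex, a minimal release separation (period) `T` and a constrained relative
deadline `D ≤ T`. An edge from `u` to `v` means that `v` can only be executed after `u` is
finished. -/
structure DAGTask (V : Type*) where
  G : Digraph V
  acyclic : ∀ v, ¬ Relation.TransGen G.Adj v v
  c : V → ℝ
  c_nonneg : ∀ v, 0 ≤ c v
  T : ℝ
  D : ℝ
  constrained : D ≤ T

namespace DAGTask

/-- Total worst-case execution time `C` of all vertices. -/
noncomputable def C {V : Type*} [Fintype V] (τ : DAGTask V) : ℝ := ∑ v, τ.c v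

/-- Length `L` of a longest chain (critical path): the maximal sum of `c v` over the vertices of a
directed path. For a finite acyclic graph the supremum is over a finite, non-empty set. -/
noncomputable def L {V : Type*} (τ : DAGTask V) : ℝ :=
  sSup {l : ℝ | ∃ π : List V, π.IsChain τ.G.Adj ∧ l = (π.map τ.c).sum}

/-- The minimal capacity requirement `γ = (C - L) / (D - L)`. -/
noncomputable def gamma {V : Type*} [Fintype V] (τ : DAGTask V) : ℝ :=
  (τ.C - τ.L) / (τ.D - τ.L)

end DAGTask

/-- `S_m`, the sum of all speeds (load bounds). -/
noncomputable def totalCapacity {m : ℕ} (δ : Fin m → ℝ) : ℝ := ∑ p, δ p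

/-- The uniformity `λ = max_x (S_m - S_x) / δ_x` of `m` speeds (load bounds) listed in
non-increasing order, where `S_x` is the sum of the `x` largest ones. A member of speed zero (no
processor at all) contributes no quotient. -/
noncomputable def speedUniformity {m : ℕ} (δ : Fin m → ℝ) : ℝ :=
  ⨆ x : {x : Fin m // 0 < δ x}, (totalCapacity δ - ∑ j ∈ Finset.Iic x.1, δ j) / δ x.1

/-- The response-time bound `(C + λ L) / S_m` for a task executed on load bounds `δ`. -/
noncomputable def responseBound {V : Type*} [Fintype V] {m : ℕ} (τ : DAGTask V)
    (δ : Fin m → ℝ) : ℝ :=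
  (τ.C + speedUniformity δ * τ.L) / totalCapacity δ

/-- A state of the execution of a DAG task through `m` container tasks. Jobs (releases) are numbered
`0, 1, 2, …`, and `(k, v)` is vertex `v` of job `k`. -/
structure ExecState (V : Type*) (m : ℕ) where
  /-- current time -/
  now : ℝ
  /-- number of jobs released so far -/
  jobs : ℕ
  /-- release times of the jobs released so far -/
  rel : ℕ → ℝ
  /-- the set `S` of vertices that still have to be dispatched, wholly or in part -/
  S : Set (ℕ × V)
  /-- the worst-case execution time of the part of the vertex that is in `S` -/
  rem : ℕ × V → ℝ
  /-- the vertex whose part was last put into the container; `none` if there was none so far or if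
  that part has finished ahead of the deadline of the container -/
  exe : Fin m → Option (ℕ × V)
  /-- the absolute deadlines of the containers -/
  d : Fin m → ℝ

namespace ExecState

variable {V : Type*} {m : ℕ}

/-- The initial state: nothing has been released and all containers are empty. -/
noncomputable def init (V : Type*) (m : ℕ) : ExecState V m where
  now := 0
  jobs := 0
  rel := fun _ => 0
  S := ∅
  rem := fun _ => 0
  exe := fun _ => none
  d := fun _ => 0

/-- A container is occupied until time reaches its absolute deadline, even if the part it executes
finishes earlier. -/
def Occupied (s : ExecState V m) (p : Fin m) : Prop := s.now < s.d p

/-- Some part of the vertex `a` has been dispatched and is not finished yet. Each container finishes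
its assigned workload no later than its absolute deadline, so such a part is unfinished only while
its container is occupied. -/
def Running (s : ExecState V m) (a : ℕ × V) : Prop := ∃ p, s.Occupied p ∧ s.exe p = some a

/-- Vertex `v` of job `k` is completely finished. -/
def Finished (s : ExecState V m) (k : ℕ) (v : V) : Prop :=
  k < s.jobs ∧ (k, v) ∉ s.S ∧ ¬ s.Running (k, v)

/-- The (remaining part of the) vertex `v` of job `k` can be executed now: it is in `S`, all
predecessors of `v` in the same job are finished, and no earlier part of it is unfinished. -/
def Eligible (τ : DAGTask V) (s : ExecState V m) (k : ℕ) (v : V) : Prop :=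
  (k, v) ∈ s.S ∧ ¬ s.Running (k, v) ∧ ∀ u, τ.G.Adj u v → s.Finished k u

/-- The empty container `p` has the largest load bound among the empty ones. Containers with load
bound zero cannot execute anything and are never used. -/
def IsFastestEmpty (δ : Fin m → ℝ) (s : ExecState V m) (p : Fin m) : Prop :=
  0 < δ p ∧ ¬ s.Occupied p ∧ ∀ q, ¬ s.Occupied q → δ q ≤ δ p

/-- The dispatcher has to be invoked: there are both an eligible vertex and an empty container. -/
def MustDispatch (τ : DAGTask V) (δ : Fin m → ℝ) (s : ExecState V m) : Prop :=
  (∃ k v, s.Eligible τ k v) ∧ ∃ p, s.IsFastestEmpty δ p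

end ExecState

open Classical in
/-- The steps of an execution of `τ` by the dispatcher on containers with load bounds `δ`, where
every container finishes each assigned part no later than its absolute deadline. -/
inductive ExecStep {V : Type*} {m : ℕ} (τ : DAGTask V) (δ : Fin m → ℝ) :
    ExecState V m → ExecState V m → Prop
  /-- A new job is released, at least `T` after all the earlier ones. If the dispatcher has to act at
  the very same instant for earlier jobs, it does so first. -/
  | release (s : ExecState V m)
      (hquiet : ¬ s.MustDispatch τ δ)
      (hsep : ∀ k < s.jobs, s.rel k + τ.T ≤ s.now) :
      ExecStep τ δ s
        { s with
          jobs := s.jobs + 1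
          rel := Function.update s.rel s.jobs s.now
          S := s.S ∪ {a | a.1 = s.jobs}
          rem := fun a => if a.1 = s.jobs then τ.c a.2 else s.rem a }
  /-- An arbitrary eligible vertex is put as a whole into the fastest empty container `p`. This
  happens if its deadline `now + rem / δ p` will be earlier than the deadlines of all the occupied
  containers with a strictly larger load bound (in particular if there are none). -/
  | dispatchWhole (s : ExecState V m) (k : ℕ) (v : V) (p : Fin m)
      (hel : s.Eligible τ k v)
      (hp : s.IsFastestEmpty δ p)
      (hlt : ∀ q, s.Occupied q → δ p < δ q → s.now + s.rem (k, v) / δ p < s.d q) :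
      ExecStep τ δ s
        { s with
          S := s.S \ {(k, v)}
          exe := Function.update s.exe p (some (k, v))
          d := Function.update s.d p (s.now + s.rem (k, v) / δ p) }
  /-- Otherwise the vertex is split: with `d q` the earliest deadline of the occupied containers
  with a strictly larger load bound, a first part of size `(d q - now) * δ p` is put into the fastest
  empty container `p` with deadline `d q`, and the rest of the vertex stays in `S`. -/
  | dispatchSplit (s : ExecState V m) (k : ℕ) (v : V) (p q : Fin m)
      (hel : s.Eligible τ k v)
      (hp : s.IsFastestEmpty δ p)
      (hq : s.Occupied q ∧ δ p < δ q)
      (hmin : ∀ q', s.Occupied q' → δ p < δ q' → s.d q ≤ s.d q')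
      (hle : s.d q ≤ s.now + s.rem (k, v) / δ p) :
      ExecStep τ δ s
        { s with
          rem := Function.update s.rem (k, v) (s.rem (k, v) - (s.d q - s.now) * δ p)
          exe := Function.update s.exe p (some (k, v))
          d := Function.update s.d p (s.d q) }
  /-- The part executed by the occupied container `p` finishes ahead of the deadline. The container
  stays occupied. -/
  | finishEarly (s : ExecState V m) (p : Fin m) (hp : s.Occupied p) :
      ExecStep τ δ s { s with exe := Function.update s.exe p none }
  /-- Time passes, at most until the next deadline of an occupied container; it cannot pass while
  the dispatcher has to act. -/
  | elapse (s : ExecState V m) (t : ℝ)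
      (hquiet : ¬ s.MustDispatch τ δ)
      (hnow : s.now ≤ t)
      (hdl : ∀ p, s.Occupied p → t ≤ s.d p) :
      ExecStep τ δ s { s with now := t }

/-- The states that occur in the executions of `τ` on containers with load bounds `δ`. -/
def ReachableState {V : Type*} {m : ℕ} (τ : DAGTask V) (δ : Fin m → ℝ)
    (s : ExecState V m) : Prop :=
  Relation.ReflTransGen (ExecStep τ δ) (ExecState.init V m) s

/-- The response time of `τ` on containers with load bounds `δ` is at most `R`: in every execution
each job is finished, with all its vertices, no later than `R` time units after its release. -/
def ResponseTimeLE {V : Type*} {m : ℕ} (τ : DAGTask V) (δ : Fin m → ℝ) (R : ℝ) : Prop :=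
  ∀ s : ExecState V m, ReachableState τ δ s →
    ∀ k < s.jobs, s.rel k + R < s.now → ∀ v, s.Finished k v

/-- `τ` is schedulable on containers with load bounds `δ`: no job misses its deadline. -/
def Schedulable {V : Type*} {m : ℕ} (τ : DAGTask V) (δ : Fin m → ℝ) : Prop :=
  ResponseTimeLE τ δ τ.D

/-- `⌊γ⌋` containers with load bound `1` followed by one with load bound `γ - ⌊γ⌋`. -/
noncomputable def floorPlusOne (γ : ℝ) : Fin (⌊γ⌋₊ + 1) → ℝ :=
  fun p => if p.val < ⌊γ⌋₊ then 1 else γ - ⌊γ⌋₊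

/-!
The proof is a potential argument along an execution. For a state in which the last job was released
at time `r`, let `W` be the work still to be done: the amounts not yet dispatched together with
`(d p - now) * δ p` for every occupied container `p`. For a directed path `π` let `ℓ π` be the part
of that work which belongs to the vertices of `π`. As long as something remains to be dispatched,

  `γ * (now - r) + W + (γ - 1) * ℓ π ≤ γ * D`  for every directed path `π`.

At a release this is `C + (γ - 1) * L = γ * D`. Dispatching moves work around without changing `W`
or `ℓ`, and an early completion only lowers `ℓ`. While time passes there are two cases.
If all containers of positive load bound are occupied, `W` decreases at rate `S_m = γ`. Otherwise
every ready vertex is being executed, and by the splitting rule the occupied containers all have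
load bound `1`, since a slower container is occupied only while all faster ones are
(`ExecInvariant.order`). Then `W` decreases at rate at least `1`. Every path extends, up to finished
vertices, to one that starts with a running vertex (`ExecState.exists_chain_running`), so the largest
`ℓ` also decreases at rate at least `1`, and `γ - 1 - (γ - 1) = 0` closes the balance.

The potential bounds the deadline of every container by `r + D`: a part `c` put into a container of
load bound `1` counts once in `W` and once in `ℓ`, so `γ * (now - r) + γ * c ≤ γ * D`, and deadlines
of slower containers are capped by those of faster ones. Because `D ≤ T`, each job therefore meets
only empty containers at its release, which makes the invariant inductive over the releases.
-/

/-! ### Directed paths in a DAG task -/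

namespace DAGTask

variable {V : Type*} (τ : DAGTask V)

theorem wellFounded_adj [Finite V] : WellFounded τ.G.Adj := by
  have : Std.Irrefl (Relation.TransGen τ.G.Adj) := ⟨τ.acyclic⟩
  exact Subrelation.wf (fun h => Relation.TransGen.single h)
    (Finite.wellFounded_of_trans_of_irrefl (Relation.TransGen τ.G.Adj))

theorem nodup_of_isChain {π : List V} (h : π.IsChain τ.G.Adj) : π.Nodup := by
  have h1 : π.IsChain (Relation.TransGen τ.G.Adj) := h.imp fun _ _ => Relation.TransGen.single
  refine (List.isChain_iff_pairwise.1 h1).imp ?_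
  rintro a _ hab rfl
  exact τ.acyclic a hab

variable [Fintype V]

theorem chain_sum_le_C {π : List V} (h : π.IsChain τ.G.Adj) : (π.map τ.c).sum ≤ τ.C := by
  classical
  rw [← List.sum_toFinset _ (τ.nodup_of_isChain h)]
  exact Finset.sum_le_sum_of_subset_of_nonneg (Finset.subset_univ _) fun v _ _ => τ.c_nonneg v

theorem chain_sum_le_L {π : List V} (h : π.IsChain τ.G.Adj) : (π.map τ.c).sum ≤ τ.L := by
  refine le_csSup ⟨τ.C, ?_⟩ ⟨π, h, rfl⟩
  rintro _ ⟨ρ, hρ, rfl⟩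
  exact τ.chain_sum_le_C hρ

end DAGTask

/-! ### Remaining work in a state -/

namespace ExecState

variable {V : Type*} {m : ℕ}

open Classical in
/-- The amount of the vertex `a` (a pair of job number and vertex) that is not dispatched yet. -/
noncomputable def pending (s : ExecState V m) (a : ℕ × V) : ℝ := if a ∈ s.S then s.rem a else 0

/-- The work that container `p` can still do before its deadline. It stays reserved after an early
completion. -/
noncomputable def load (δ : Fin m → ℝ) (s : ExecState V m) (p : Fin m) : ℝ :=
  max (s.d p - s.now) 0 * δ p

open Classical in
/-- The unfinished amount of the vertex `a`: the pending amount and the loads of the containers that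
execute a part of it. -/
noncomputable def vertexWork (δ : Fin m → ℝ) (s : ExecState V m) (a : ℕ × V) : ℝ :=
  s.pending a + ∑ p, if s.exe p = some a then s.load δ p else 0

/-- The remaining work `W` of job `k`: its pending amounts and the loads of all containers. -/
noncomputable def work [Fintype V] (δ : Fin m → ℝ) (s : ExecState V m) (k : ℕ) : ℝ :=
  ∑ v, s.pending (k, v) + ∑ p, s.load δ p

variable {δ : Fin m → ℝ} {s : ExecState V m}

theorem load_nonneg (hδ : ∀ p, 0 ≤ δ p) (p : Fin m) : 0 ≤ s.load δ p :=
  mul_nonneg (le_max_right _ _) (hδ p)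

theorem load_eq_zero {p : Fin m} (h : ¬ s.Occupied p) : s.load δ p = 0 := by
  rw [Occupied, not_lt] at h
  rw [load, max_eq_right (by linarith), zero_mul]

theorem pending_le_vertexWork (hδ : ∀ p, 0 ≤ δ p) (a : ℕ × V) :
    s.pending a ≤ s.vertexWork δ a := by
  refine le_add_of_nonneg_right (Finset.sum_nonneg fun p _ => ?_)
  split_ifs
  exacts [load_nonneg hδ p, le_rfl]

theorem vertexWork_eq_pending {a : ℕ × V} (h : ¬ s.Running a) :
    s.vertexWork δ a = s.pending a := by
  refine add_eq_left.2 (Finset.sum_eq_zero fun p _ => ?_)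
  split_ifs with hp
  · exact load_eq_zero fun ho => h ⟨p, ho, hp⟩
  · rfl

theorem vertexWork_of_finished {k : ℕ} {v : V} (h : s.Finished k v) :
    s.vertexWork δ (k, v) = 0 := by
  rw [vertexWork_eq_pending h.2.2, pending, if_neg h.2.1]

theorem pending_le_work [Fintype V] (hδ : ∀ p, 0 ≤ δ p) (hs : ∀ a, 0 ≤ s.pending a) (k : ℕ)
    (v : V) : s.pending (k, v) ≤ s.work δ k :=
  le_add_of_le_of_nonneg
    (Finset.single_le_sum (f := fun v => s.pending (k, v)) (fun _ _ => hs _) (Finset.mem_univ v))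
    (Finset.sum_nonneg fun p _ => load_nonneg hδ p)

theorem vertexWork_nonneg (hδ : ∀ p, 0 ≤ δ p) (hs : ∀ a, 0 ≤ s.pending a) (a : ℕ × V) :
    0 ≤ s.vertexWork δ a :=
  (hs a).trans (pending_le_vertexWork hδ a)

theorem exists_isFastestEmpty {p : Fin m} (hp : 0 < δ p) (ho : ¬ s.Occupied p) :
    ∃ q, s.IsFastestEmpty δ q := by
  classical
  obtain ⟨q, hq, hmax⟩ := Finset.exists_max_image (Finset.univ.filter fun q => ¬ s.Occupied q) δ
    ⟨p, by simpa using ho⟩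
  simp only [Finset.mem_filter, Finset.mem_univ, true_and] at hq hmax
  exact ⟨q, hp.trans_le (hmax p ho), hq, hmax⟩

/-- If no vertex of a released job `k` is eligible, every unfinished vertex is preceded on some path
by a running one (or is running itself). -/
theorem exists_chain_cons_running [Finite V] (τ : DAGTask V) {k : ℕ} (hk : k < s.jobs)
    (hel : ∀ v, ¬ s.Eligible τ k v) (v : V) :
    ¬ s.Finished k v → ∀ ρ, (v :: ρ).IsChain τ.G.Adj →
      ∃ u σ, s.Running (k, u) ∧ (u :: (σ ++ ρ)).IsChain τ.G.Adj ∧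
        (v :: ρ).IsSuffix (u :: (σ ++ ρ)) := by
  induction v using τ.wellFounded_adj.induction with
  | _ v ih =>
    intro hv ρ hρ
    by_cases hr : s.Running (k, v)
    · exact ⟨v, [], hr, hρ, List.suffix_rfl⟩
    have hS : (k, v) ∈ s.S := by
      by_contra hS
      exact hv ⟨hk, hS, hr⟩
    obtain ⟨w, hwv, hw⟩ : ∃ w, τ.G.Adj w v ∧ ¬ s.Finished k w := by
      by_contra! h
      exact hel v ⟨hS, hr, h⟩
    obtain ⟨u, σ, hu, hc, hsuf⟩ := ih w hwv hw (v :: ρ) (List.isChain_cons_cons.2 ⟨hwv, hρ⟩)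
    refine ⟨u, σ ++ [v], hu, by simpa using hc, ?_⟩
    simp

/-- Let `f v` and `g v` be the unfinished amounts of the vertices of a released job `k` now and after
`t` units of time, during which every running vertex loses at least `t`. If no vertex is eligible but
some vertex is unfinished, then the amount on any path at the end, plus `t`, is at most the present
amount on some path: a path that starts with a running vertex and contains all unfinished vertices
of the given one. -/
theorem exists_chain_running [Finite V] (τ : DAGTask V) {k : ℕ} (hk : k < s.jobs)
    (hel : ∀ v, ¬ s.Eligible τ k v) (hun : ∃ v, ¬ s.Finished k v) {f g : V → ℝ} {t : ℝ}
    (hg : ∀ v, 0 ≤ g v) (hgf : ∀ v, g v ≤ f v) (hfin : ∀ v, s.Finished k v → g v = 0)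
    (hrun : ∀ u, s.Running (k, u) → g u + t ≤ f u) (π : List V) (hπ : π.IsChain τ.G.Adj) :
    ∃ π' : List V, π'.IsChain τ.G.Adj ∧ (π.map g).sum + t ≤ (π'.map f).sum := by
  have key : ∀ v ρ, ¬ s.Finished k v → (v :: ρ).IsChain τ.G.Adj →
      ∃ π' : List V, π'.IsChain τ.G.Adj ∧ ((v :: ρ).map g).sum + t ≤ (π'.map f).sum := by
    intro v ρ hv hρ
    obtain ⟨u, σ, hu, hc, hsuf⟩ := exists_chain_cons_running τ hk hel v hv ρ hρ
    refine ⟨_, hc, ?_⟩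
    have h1 : ((v :: ρ).map g).sum ≤ ((u :: (σ ++ ρ)).map g).sum :=
      (hsuf.map g).sublist.sum_le_sum fun x hx => by
        obtain ⟨y, -, rfl⟩ := List.mem_map.1 hx
        exact hg y
    have h2 : ((σ ++ ρ).map g).sum ≤ ((σ ++ ρ).map f).sum :=
      List.sum_le_sum fun x _ => hgf x
    rw [List.map_cons, List.sum_cons] at h1 ⊢
    have := hrun u hu
    rw [List.map_cons, List.sum_cons] at *
    linarith
  induction π with
  | nil =>
    obtain ⟨v, hv⟩ := hun
    obtain ⟨π', h1, h2⟩ := key v [] hv (List.isChain_singleton v)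
    refine ⟨π', h1, le_trans ?_ h2⟩
    simpa using hg v
  | cons v ρ ih =>
    by_cases hv : s.Finished k v
    · obtain ⟨π', h1, h2⟩ := ih hπ.tail
      exact ⟨π', h1, by simpa [hfin v hv] using h2⟩
    · exact key v ρ hv hπ

end ExecState

/-! ### The invariant of an execution -/

section Invariant

open ExecState

variable {V : Type*} {m : ℕ}

/-- The invariant of the reachable states. At most the last job, number `jobs - 1`, is still active;
before the first release nothing is pending and no container is occupied. -/
structure ExecInvariant [Fintype V] (τ : DAGTask V) (δ : Fin m → ℝ) (s : ExecState V m) :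
    Prop where
  job_of_mem : ∀ a ∈ s.S, a.1 + 1 = s.jobs
  job_of_exe : ∀ p a, s.Occupied p → s.exe p = some a → a.1 + 1 = s.jobs
  deadline : ∀ p, s.Occupied p → 0 < s.jobs ∧ s.d p ≤ s.rel (s.jobs - 1) + τ.D
  pending_nonneg : ∀ a, 0 ≤ s.pending a
  order : ∀ p q, s.Occupied p → δ p < δ q → s.d p ≤ s.d q
  potential : s.S.Nonempty → ∀ π : List V, π.IsChain τ.G.Adj →
    totalCapacity δ * (s.now - s.rel (s.jobs - 1)) + s.work δ (s.jobs - 1) +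
      (totalCapacity δ - 1) * (π.map fun v => s.vertexWork δ (s.jobs - 1, v)).sum
        ≤ totalCapacity δ * τ.D

/-- The properties of the load bounds that the schedulability argument uses: apart from at most one
container, all containers with positive load bound have load bound `1`, the largest one; and the
total is the one that balances the potential at a release. -/
structure BalancedLoads [Fintype V] (τ : DAGTask V) (δ : Fin m → ℝ) : Prop where
  nonneg : ∀ p, 0 ≤ δ p
  eq_one : ∀ p q, p ≠ q → 0 < δ p → δ p ≤ δ q → δ q = 1
  eq_one_or_lt : ∀ p, δ p = 1 ∨ ∃ q, δ p < δ q
  one_le : 1 ≤ totalCapacity δ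
  balance : τ.C + (totalCapacity δ - 1) * τ.L ≤ totalCapacity δ * τ.D

namespace ExecInvariant

variable [Fintype V] {τ : DAGTask V} {δ : Fin m → ℝ} {s : ExecState V m}

theorem init : ExecInvariant τ δ (ExecState.init V m) where
  job_of_mem a ha := ha.elim
  job_of_exe p a h := (lt_irrefl _ h).elim
  deadline p h := (lt_irrefl _ h).elim
  pending_nonneg a := by simp [pending, ExecState.init]
  order p q h := (lt_irrefl _ h).elim
  potential h := (Set.not_nonempty_empty h).elim

theorem finishEarly (hδ : BalancedLoads τ δ) (h : ExecInvariant τ δ s) (p : Fin m) :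
    ExecInvariant τ δ { s with exe := Function.update s.exe p none } where
  job_of_mem := h.job_of_mem
  job_of_exe q a hq ha := by
    by_cases hqp : q = p
    · subst hqp
      simp at ha
    · exact h.job_of_exe q a hq (by simpa [hqp] using ha)
  deadline := h.deadline
  pending_nonneg := h.pending_nonneg
  order := h.order
  potential hS π hπ := by
    refine le_trans ?_ (h.potential hS π hπ)
    refine add_le_add (le_refl (totalCapacity δ * (s.now - s.rel (s.jobs - 1)) +
      s.work δ (s.jobs - 1))) (mul_le_mul_of_nonneg_left ?_ (sub_nonneg.2 hδ.one_le))
    refine List.sum_le_sum fun v _ => add_le_add (le_refl (s.pending _))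
      (Finset.sum_le_sum fun q _ => ?_)
    have himp : Function.update s.exe p none q = some (s.jobs - 1, v) →
        s.exe q = some (s.jobs - 1, v) := by
      by_cases hqp : q = p
      · subst hqp
        simp
      · rw [Function.update_of_ne hqp]
        exact id
    split_ifs with h1 h2 h2
    · rfl
    · exact absurd (himp h1) h2
    · exact load_nonneg hδ.nonneg q
    · rfl

/-- Putting a part of an eligible vertex, of size `(x - now) * δ p`, into the fastest empty container
`p` with deadline `x`. This covers the dispatching of a whole vertex and of a split one. -/
theorem dispatch (hδ : BalancedLoads τ δ) (h : ExecInvariant τ δ s) {s' : ExecState V m}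
    {k : ℕ} {v : V} {p : Fin m} {x : ℝ} (hel : s.Eligible τ k v) (hp : s.IsFastestEmpty δ p)
    (hnow : s'.now = s.now) (hjobs : s'.jobs = s.jobs) (hrel : s'.rel = s.rel) (hS : s'.S ⊆ s.S)
    (hexe : s'.exe = Function.update s.exe p (some (k, v)))
    (hd : s'.d = Function.update s.d p x) (hx : s.now ≤ x)
    (hpend : s'.pending (k, v) + (x - s.now) * δ p = s.pending (k, v))
    (hpend_nonneg : 0 ≤ s'.pending (k, v))
    (hpend_ne : ∀ a, a ≠ (k, v) → s'.pending a = s.pending a)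
    (hxd : ∀ q, s.Occupied q → δ p < δ q → x ≤ s.d q) : ExecInvariant τ δ s' := by
  classical
  have hk : k + 1 = s.jobs := h.job_of_mem _ hel.1
  have hk' : s.jobs - 1 = k := by omega
  have hocc : ∀ q, q ≠ p → s'.Occupied q → s.Occupied q := by
    intro q hq ho
    simpa [Occupied, hnow, hd, hq] using ho
  have hfaster : ∀ q, δ p < δ q → s.Occupied q := fun q hq => by
    by_contra ho
    exact absurd (hp.2.2 q ho) (not_le.2 hq)
  have hload : ∀ q, q ≠ p → s'.load δ q = s.load δ q := by
    intro q hq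
    simp [load, hnow, hd, hq]
  have hloadp : s'.load δ p = (x - s.now) * δ p := by
    simp [load, hnow, hd, hx]
  have hwork : s'.work δ k = s.work δ k := by
    have h1 := Finset.add_sum_erase Finset.univ (fun w => s.pending (k, w)) (Finset.mem_univ v)
    have h2 := Finset.add_sum_erase Finset.univ (fun w => s'.pending (k, w)) (Finset.mem_univ v)
    have h3 := Finset.add_sum_erase Finset.univ (fun q => s.load δ q) (Finset.mem_univ p)
    have h4 := Finset.add_sum_erase Finset.univ (fun q => s'.load δ q) (Finset.mem_univ p)
    have h5 : ∑ w ∈ Finset.univ.erase v, s'.pending (k, w) =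
        ∑ w ∈ Finset.univ.erase v, s.pending (k, w) :=
      Finset.sum_congr rfl fun w hw => hpend_ne _ fun e =>
        Finset.ne_of_mem_erase hw (Prod.ext_iff.1 e).2
    have h6 : ∑ q ∈ Finset.univ.erase p, s'.load δ q = ∑ q ∈ Finset.univ.erase p, s.load δ q :=
      Finset.sum_congr rfl fun q hq => hload _ (Finset.ne_of_mem_erase hq)
    have h7 : s.load δ p = 0 := load_eq_zero hp.2.1
    simp only [work]
    linarith
  have hres : ∀ a, s'.vertexWork δ a = s.vertexWork δ a := by
    intro a
    have hrest : ∀ q, q ≠ p → (if s'.exe q = some a then s'.load δ q else 0) =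
        if s.exe q = some a then s.load δ q else 0 := by
      intro q hq
      rw [hload q hq, hexe, Function.update_of_ne hq]
    have h3 := Finset.add_sum_erase Finset.univ
      (fun q => if s.exe q = some a then s.load δ q else 0) (Finset.mem_univ p)
    have h4 := Finset.add_sum_erase Finset.univ
      (fun q => if s'.exe q = some a then s'.load δ q else 0) (Finset.mem_univ p)
    have h6 := Finset.sum_congr (rfl : Finset.univ.erase p = _)
      fun q hq => hrest q (Finset.ne_of_mem_erase hq)
    have h7 : s.load δ p = 0 := load_eq_zero hp.2.1
    simp only [h7, ite_self, zero_add] at h3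
    simp only [vertexWork]
    rw [← h3, ← h4, h6, hexe, Function.update_self, hloadp]
    by_cases ha : a = (k, v)
    · subst ha
      rw [if_pos rfl]
      linarith
    · rw [if_neg (by simpa [eq_comm] using ha), hpend_ne a ha, zero_add]
  have hxD : x ≤ s.rel (s.jobs - 1) + τ.D := by
    rcases hδ.eq_one_or_lt p with h1 | ⟨q, hq⟩
    · -- The part counts once in the work and once on the one-vertex path `[v]`.
      have hpot := h.potential ⟨_, hel.1⟩ [v] (List.isChain_singleton v)
      have hw := pending_le_work hδ.nonneg h.pending_nonneg k v
      have hr := pending_le_vertexWork (s := s) hδ.nonneg (k, v)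
      simp only [List.map_cons, List.map_nil, List.sum_cons, List.sum_nil, add_zero] at hpot
      rw [hk'] at hpot ⊢
      rw [h1, mul_one] at hpend
      have hg := hδ.one_le
      have h2 := mul_le_mul_of_nonneg_left (a := totalCapacity δ - 1)
        (show x - s.now ≤ s.vertexWork δ (k, v) by linarith) (by linarith)
      have h3 : totalCapacity δ * (x - s.rel k) ≤ totalCapacity δ * τ.D := by nlinarith
      have := le_of_mul_le_mul_left h3 (by linarith)
      linarith
    · exact (hxd q (hfaster q hq) hq).trans (h.deadline q (hfaster q hq)).2
  exact
    { job_of_mem := fun a ha => hjobs ▸ h.job_of_mem a (hS ha)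
      job_of_exe := fun q a hq ha => by
        rw [hjobs]
        by_cases hqp : q = p
        · subst hqp
          rw [hexe, Function.update_self, Option.some_inj] at ha
          rw [← ha]
          exact hk
        · rw [hexe, Function.update_of_ne hqp] at ha
          exact h.job_of_exe q a (hocc q hqp hq) ha
      deadline := fun q hq => by
        rw [hjobs, hrel]
        by_cases hqp : q = p
        · subst hqp
          rw [hd, Function.update_self]
          exact ⟨by omega, hxD⟩
        · rw [hd, Function.update_of_ne hqp]
          exact h.deadline q (hocc q hqp hq)
      pending_nonneg := fun a => by
        by_cases ha : a = (k, v)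
        · rw [ha]
          exact hpend_nonneg
        · rw [hpend_ne a ha]
          exact h.pending_nonneg a
      order := fun q r hq hqr => by
        by_cases hqp : q = p
        · subst hqp
          have hrq : r ≠ q := by
            rintro rfl
            exact lt_irrefl _ hqr
          rw [hd, Function.update_self, Function.update_of_ne hrq]
          exact hxd r (hfaster r hqr) hqr
        · have ho := hocc q hqp hq
          by_cases hrp : r = p
          · subst hrp
            exact absurd (lt_of_lt_of_le ho (h.order q r ho hqr)) hp.2.1
          · rw [hd, Function.update_of_ne hqp, Function.update_of_ne hrp]
            exact h.order q r ho hqr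
      potential := fun _ π hπ => by
        have := h.potential ⟨_, hel.1⟩ π hπ
        simpa only [hnow, hjobs, hrel, hk', hwork, hres] using this }

/-- While something remains to be dispatched, the potential does not grow with time. -/
theorem potential_elapse (hδ : BalancedLoads τ δ) (h : ExecInvariant τ δ s) {t : ℝ}
    (hquiet : ¬ s.MustDispatch τ δ) (hnow : s.now ≤ t) (hdl : ∀ p, s.Occupied p → t ≤ s.d p)
    (hS : s.S.Nonempty) (π : List V) (hπ : π.IsChain τ.G.Adj) :
    totalCapacity δ * (t - s.rel (s.jobs - 1)) + ({ s with now := t }).work δ (s.jobs - 1) +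
      (totalCapacity δ - 1) *
        (π.map fun v => ({ s with now := t }).vertexWork δ (s.jobs - 1, v)).sum
        ≤ totalCapacity δ * τ.D := by
  classical
  set s' : ExecState V m := { s with now := t }
  set k := s.jobs - 1 with hk
  have hg := hδ.one_le
  have hload : ∀ p, s'.load δ p ≤ s.load δ p := fun p =>
    mul_le_mul_of_nonneg_right
      (max_le_max (sub_le_sub_left hnow _) le_rfl) (hδ.nonneg p)
  have hload_occ : ∀ p, s.Occupied p → s'.load δ p + (t - s.now) * δ p = s.load δ p := by
    intro p hp
    have h1 : 0 ≤ s.d p - t := sub_nonneg.2 (hdl p hp)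
    have h2 : 0 ≤ s.d p - s.now := by linarith
    simp only [load, s', max_eq_left h1, max_eq_left h2]
    ring
  have hpend : ∀ a, s'.pending a = s.pending a := fun _ => rfl
  have hterm : ∀ (a : ℕ × V) p, (if s'.exe p = some a then s'.load δ p else 0) ≤
      if s.exe p = some a then s.load δ p else 0 := by
    intro a p
    change (if s.exe p = some a then s'.load δ p else 0) ≤ _
    split_ifs
    exacts [hload p, le_rfl]
  have hres : ∀ a, s'.vertexWork δ a ≤ s.vertexWork δ a := fun a =>
    add_le_add le_rfl (Finset.sum_le_sum fun p _ => hterm a p)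
  by_cases hfull : ∀ p, 0 < δ p → s.Occupied p
  · -- All usable containers are occupied: the work decreases at rate `totalCapacity δ`.
    have hl : ∀ p, s'.load δ p + (t - s.now) * δ p = s.load δ p := by
      intro p
      rcases (hδ.nonneg p).eq_or_lt with h0 | h0
      · simp [load, ← h0]
      · exact hload_occ p (hfull p h0)
    have hw : s'.work δ k + (t - s.now) * totalCapacity δ = s.work δ k := by
      simp only [work, totalCapacity, Finset.mul_sum, hpend, add_assoc,
        ← Finset.sum_add_distrib, hl]
    have h1 : (π.map fun v => s'.vertexWork δ (k, v)).sum ≤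
        (π.map fun v => s.vertexWork δ (k, v)).sum := List.sum_le_sum fun v _ => hres _
    have h2 := mul_le_mul_of_nonneg_left h1 (sub_nonneg.2 hg)
    have h3 := h.potential hS π hπ
    rw [← hk] at h3
    nlinarith
  · push Not at hfull
    obtain ⟨p₀, hp₀, ho₀⟩ := hfull
    have hel : ∀ v, ¬ s.Eligible τ k v := fun v hv =>
      hquiet ⟨⟨k, v, hv⟩, exists_isFastestEmpty hp₀ ho₀⟩
    have hone : ∀ p, s.Occupied p → δ p = 1 := by
      intro p hp
      refine hδ.eq_one p₀ p (fun e => ho₀ (e ▸ hp)) hp₀ (not_lt.1 fun hlt => ho₀ ?_)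
      exact lt_of_lt_of_le hp (h.order p p₀ hp hlt)
    obtain ⟨⟨k', v₀⟩, hv₀⟩ := hS
    have hk' := h.job_of_mem _ hv₀
    obtain rfl : k' = k := by simp only at hk'; omega
    have hkj : k < s.jobs := by simp only at hk'; omega
    have hv₀' : ¬ s.Finished k v₀ := fun hf => hf.2.1 hv₀
    obtain ⟨u, -, ⟨p, hp, -⟩, -⟩ := exists_chain_cons_running τ hkj hel v₀ hv₀' []
      (List.isChain_singleton v₀)
    have hw : s'.work δ k + (t - s.now) ≤ s.work δ k := by
      have h1 := Finset.add_sum_erase Finset.univ (fun q => s.load δ q) (Finset.mem_univ p)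
      have h2 := Finset.add_sum_erase Finset.univ (fun q => s'.load δ q) (Finset.mem_univ p)
      have h3 : ∑ q ∈ Finset.univ.erase p, s'.load δ q ≤ ∑ q ∈ Finset.univ.erase p, s.load δ q :=
        Finset.sum_le_sum fun q _ => hload q
      have h4 := hload_occ p hp
      rw [hone p hp, mul_one] at h4
      simp only [work, hpend]
      linarith
    have hrun : ∀ u, s.Running (k, u) →
        s'.vertexWork δ (k, u) + (t - s.now) ≤ s.vertexWork δ (k, u) := by
      rintro u ⟨q, hq, hqu⟩
      have h1 := Finset.add_sum_erase Finset.univ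
        (fun q => if s.exe q = some (k, u) then s.load δ q else 0) (Finset.mem_univ q)
      have h2 := Finset.add_sum_erase Finset.univ
        (fun q => if s'.exe q = some (k, u) then s'.load δ q else 0) (Finset.mem_univ q)
      have h3 := Finset.sum_le_sum (s := Finset.univ.erase q) fun r _ => hterm (k, u) r
      have h4 := hload_occ q hq
      rw [hone q hq, mul_one] at h4
      have hqu' : s'.exe q = some (k, u) := hqu
      simp only [if_pos hqu] at h1
      simp only [if_pos hqu'] at h2
      simp only [vertexWork, hpend]
      linarith
    have hnn : ∀ v, 0 ≤ s'.vertexWork δ (k, v) := fun v =>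
      vertexWork_nonneg (s := s') hδ.nonneg h.pending_nonneg _
    obtain ⟨π', hπ', hle⟩ := exists_chain_running τ hkj hel ⟨v₀, hv₀'⟩
      (f := fun v => s.vertexWork δ (k, v)) (g := fun v => s'.vertexWork δ (k, v)) hnn
      (fun v => hres _)
      (fun v hv => le_antisymm ((hres _).trans_eq (vertexWork_of_finished hv)) (hnn v))
      hrun π hπ
    have h2 := mul_le_mul_of_nonneg_left hle (sub_nonneg.2 hg)
    have h3 := h.potential ⟨_, hv₀⟩ π' hπ'
    rw [← hk] at h3
    nlinarith

theorem elapse (hδ : BalancedLoads τ δ) (h : ExecInvariant τ δ s) {t : ℝ}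
    (hquiet : ¬ s.MustDispatch τ δ) (hnow : s.now ≤ t) (hdl : ∀ p, s.Occupied p → t ≤ s.d p) :
    ExecInvariant τ δ { s with now := t } where
  job_of_mem := h.job_of_mem
  job_of_exe p a hp := h.job_of_exe p a (hnow.trans_lt hp)
  deadline p hp := h.deadline p (hnow.trans_lt hp)
  pending_nonneg := h.pending_nonneg
  order p q hp := h.order p q (hnow.trans_lt hp)
  potential hS π hπ := h.potential_elapse hδ hquiet hnow hdl hS π hπ

/-- At a release all containers are empty. -/
theorem not_occupied_of_release (h : ExecInvariant τ δ s)
    (hsep : ∀ k < s.jobs, s.rel k + τ.T ≤ s.now) (p : Fin m) : ¬ s.Occupied p := by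
  intro hp
  obtain ⟨hj, hd⟩ := h.deadline p hp
  have h1 := hsep (s.jobs - 1) (by omega)
  have h2 : s.now < s.d p := hp
  linarith [τ.constrained]

/-- At a release nothing is left to be dispatched. -/
theorem S_eq_empty_of_release (hδ : BalancedLoads τ δ) (h : ExecInvariant τ δ s)
    (hquiet : ¬ s.MustDispatch τ δ) (hsep : ∀ k < s.jobs, s.rel k + τ.T ≤ s.now) : s.S = ∅ := by
  have hocc := h.not_occupied_of_release hsep
  obtain ⟨p, hp⟩ : ∃ p, 0 < δ p := by
    by_contra! hn
    have h1 : totalCapacity δ ≤ 0 := Finset.sum_nonpos fun p _ => hn p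
    linarith [hδ.one_le]
  refine Set.not_nonempty_iff_eq_empty.1 fun ⟨⟨k, v⟩, hv⟩ => ?_
  have hk := h.job_of_mem _ hv
  obtain ⟨u, -, ⟨q, hq, -⟩, -⟩ := exists_chain_cons_running τ (by simp only at hk; omega)
    (fun v hv => hquiet ⟨⟨k, v, hv⟩, exists_isFastestEmpty hp (hocc p)⟩) v (fun hf => hf.2.1 hv)
    [] (List.isChain_singleton v)
  exact hocc q hq

theorem release (hδ : BalancedLoads τ δ) (h : ExecInvariant τ δ s) {s' : ExecState V m}
    (hquiet : ¬ s.MustDispatch τ δ) (hsep : ∀ k < s.jobs, s.rel k + τ.T ≤ s.now)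
    (hnow : s'.now = s.now) (hjobs : s'.jobs = s.jobs + 1) (hrel : s'.rel s.jobs = s.now)
    (hS : s'.S = s.S ∪ {a | a.1 = s.jobs}) (hrem : ∀ v, s'.rem (s.jobs, v) = τ.c v)
    (hd : s'.d = s.d) : ExecInvariant τ δ s' := by
  have hocc : ∀ p, ¬ s'.Occupied p := by
    intro p
    rw [Occupied, hnow, hd]
    exact h.not_occupied_of_release hsep p
  have hmem : ∀ a, a ∈ s'.S ↔ a.1 = s.jobs := by
    intro a
    rw [hS, h.S_eq_empty_of_release hδ hquiet hsep, Set.empty_union, Set.mem_ofPred_eq]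
  have hpend : ∀ v, s'.pending (s.jobs, v) = τ.c v := fun v => by
    rw [pending, if_pos ((hmem _).2 rfl), hrem]
  refine
    { job_of_mem := fun a ha => by rw [hjobs, (hmem a).1 ha]
      job_of_exe := fun p a hp => (hocc p hp).elim
      deadline := fun p hp => (hocc p hp).elim
      pending_nonneg := ?_
      order := fun p q hp => (hocc p hp).elim
      potential := ?_ }
  · rintro ⟨k, v⟩
    by_cases hk : k = s.jobs
    · rw [hk, hpend]
      exact τ.c_nonneg v
    · rw [pending, if_neg fun ha => hk ((hmem _).1 ha)]
  · intro _ π hπ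
    have hwork : s'.work δ s.jobs = τ.C := by
      simp only [work, hpend, load_eq_zero (hocc _), Finset.sum_const_zero, add_zero, DAGTask.C]
    have hres : ∀ v, s'.vertexWork δ (s.jobs, v) = τ.c v := fun v => by
      rw [vertexWork_eq_pending fun ⟨p, hp, _⟩ => hocc p hp, hpend]
    rw [hjobs, Nat.add_sub_cancel, hrel, hnow, hwork, sub_self, mul_zero, zero_add]
    simp only [hres]
    have := mul_le_mul_of_nonneg_left (τ.chain_sum_le_L hπ) (sub_nonneg.2 hδ.one_le)
    linarith [hδ.balance]

theorem step (hδ : BalancedLoads τ δ) {s' : ExecState V m} (h : ExecInvariant τ δ s)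
    (hs : ExecStep τ δ s s') : ExecInvariant τ δ s' := by
  classical
  cases hs with
  | release hquiet hsep =>
    exact h.release hδ hquiet hsep rfl rfl (by simp) rfl (fun v => by simp) rfl
  | dispatchWhole k v p hel hp hlt =>
    have hr : s.pending (k, v) = s.rem (k, v) := if_pos hel.1
    have hr0 := h.pending_nonneg (k, v)
    have hp0 := hp.1
    refine h.dispatch hδ hel hp rfl rfl rfl Set.sdiff_subset rfl rfl
      (le_add_of_nonneg_right (div_nonneg (hr ▸ hr0) hp0.le)) ?_ ?_ ?_
      fun q hq hpq => (hlt q hq hpq).le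
    · rw [pending, if_neg (by simp), hr]
      field_simp
      ring
    · rw [pending, if_neg (by simp)]
    · intro a ha
      simp [pending, ha]
  | dispatchSplit k v p q hel hp hq hmin hle =>
    have hr : s.pending (k, v) = s.rem (k, v) := if_pos hel.1
    have hp0 := hp.1
    have hle' : (s.d q - s.now) * δ p ≤ s.rem (k, v) := by
      rw [← le_div_iff₀ hp0]
      linarith
    refine h.dispatch hδ hel hp rfl rfl rfl subset_rfl rfl rfl hq.1.le ?_ ?_ ?_
      fun r hr hpr => hmin r hr hpr
    · rw [pending, if_pos hel.1, hr]
      simp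
    · rw [pending, if_pos hel.1]
      simpa using hle'
    · intro a ha
      simp [pending, ha]
  | finishEarly p hp => exact h.finishEarly hδ p
  | elapse t hquiet hnow hdl => exact h.elapse hδ hquiet hnow hdl

theorem of_reachable (hδ : BalancedLoads τ δ) (hs : ReachableState τ δ s) :
    ExecInvariant τ δ s := by
  induction hs with
  | refl => exact init
  | tail _ hstep ih => exact ih.step hδ hstep

end ExecInvariant

theorem BalancedLoads.schedulable [Fintype V] {τ : DAGTask V} {δ : Fin m → ℝ}
    (hδ : BalancedLoads τ δ) : Schedulable τ δ := by
  intro s hs k hk hlate v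
  have h := ExecInvariant.of_reachable hδ hs
  refine ⟨hk, fun hS => ?_, fun ⟨p, hp, hexe⟩ => ?_⟩
  · have hj := h.job_of_mem _ hS
    have hk' : s.jobs - 1 = k := by simp only at hj; omega
    have hpot := h.potential ⟨_, hS⟩ [] List.isChain_nil
    have hw := (h.pending_nonneg (k, v)).trans (pending_le_work hδ.nonneg h.pending_nonneg k v)
    rw [hk'] at hpot
    simp only [List.map_nil, List.sum_nil, mul_zero, add_zero] at hpot
    have := le_of_mul_le_mul_left (show totalCapacity δ * (s.now - s.rel k) ≤
      totalCapacity δ * τ.D by linarith) (by linarith [hδ.one_le])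
    linarith
  · have hj := h.job_of_exe p _ hp hexe
    have hk' : s.jobs - 1 = k := by simp only at hj; omega
    have hd := (h.deadline p hp).2
    have hp' : s.now < s.d p := hp
    rw [hk'] at hd
    linarith

end Invariant

/-! ### The configuration with `⌊γ⌋` unit containers and one fractional container -/

theorem floorPlusOne_castSucc (γ : ℝ) (i : Fin ⌊γ⌋₊) : floorPlusOne γ i.castSucc = 1 :=
  if_pos i.isLt

theorem floorPlusOne_last (γ : ℝ) : floorPlusOne γ (Fin.last _) = γ - ⌊γ⌋₊ :=
  if_neg (lt_irrefl _)

theorem floorPlusOne_nonneg {γ : ℝ} (h : 0 ≤ γ) (p) : 0 ≤ floorPlusOne γ p := by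
  induction p using Fin.lastCases with
  | last => rw [floorPlusOne_last]; exact sub_nonneg.2 (Nat.floor_le h)
  | cast i => rw [floorPlusOne_castSucc]; exact zero_le_one

theorem totalCapacity_floorPlusOne (γ : ℝ) : totalCapacity (floorPlusOne γ) = γ := by
  simp [totalCapacity, Fin.sum_univ_castSucc, floorPlusOne_castSucc, floorPlusOne_last]

theorem speedUniformity_floorPlusOne {γ : ℝ} (h : 1 ≤ γ) :
    speedUniformity (floorPlusOne γ) = γ - 1 := by
  have h0 : 0 < ⌊γ⌋₊ := Nat.floor_pos.2 h
  have hzero : floorPlusOne γ 0 = 1 := if_pos h0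
  have : Nonempty {x // 0 < floorPlusOne γ x} := ⟨⟨0, by rw [hzero]; exact one_pos⟩⟩
  rw [speedUniformity, totalCapacity_floorPlusOne]
  refine le_antisymm (ciSup_le ?_) ?_
  · rintro ⟨x, hx⟩
    induction x using Fin.lastCases with
    | last =>
      have hI : Finset.Iic (Fin.last ⌊γ⌋₊) = Finset.univ := by
        ext i
        simp [Fin.le_last]
      have hsum := totalCapacity_floorPlusOne γ
      rw [totalCapacity] at hsum
      simp only [hI, hsum, sub_self, zero_div]
      linarith
    | cast i =>
      have hle := Finset.single_le_sum (f := floorPlusOne γ)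
        (fun p _ => floorPlusOne_nonneg (by linarith) p)
        (Finset.mem_Iic.2 (le_refl i.castSucc))
      simp only [floorPlusOne_castSucc, div_one] at hle ⊢
      linarith
  · refine le_trans (le_of_eq ?_) (le_ciSup (Set.finite_range _).bddAbove
      ⟨0, by rw [hzero]; exact one_pos⟩)
    have hI : Finset.Iic (0 : Fin (⌊γ⌋₊ + 1)) = {0} := by
      ext i
      simp
    simp [hI, hzero]

theorem balancedLoads_floorPlusOne {V : Type*} [Fintype V] (τ : DAGTask V) {γ : ℝ} (h : 1 ≤ γ)
    (hbal : τ.C + (γ - 1) * τ.L ≤ γ * τ.D) : BalancedLoads τ (floorPlusOne γ) where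
  nonneg := floorPlusOne_nonneg (by linarith)
  eq_one p q hpq hp hle := by
    induction q using Fin.lastCases with
    | cast j => exact floorPlusOne_castSucc γ j
    | last =>
      induction p using Fin.lastCases with
      | last => exact absurd rfl hpq
      | cast i =>
        rw [floorPlusOne_castSucc, floorPlusOne_last] at hle
        linarith [Nat.lt_floor_add_one γ]
  eq_one_or_lt p := by
    induction p using Fin.lastCases with
    | cast i => exact Or.inl (floorPlusOne_castSucc γ i)
    | last =>
      refine Or.inr ⟨(⟨0, Nat.floor_pos.2 h⟩ : Fin ⌊γ⌋₊).castSucc, ?_⟩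
      rw [floorPlusOne_castSucc, floorPlusOne_last]
      linarith [Nat.lt_floor_add_one γ]
  one_le := by rwa [totalCapacity_floorPlusOne]
  balance := by rwa [totalCapacity_floorPlusOne]

theorem lemmal {V : Type*} [Fintype V] (τ : DAGTask V)
    (hL : τ.L < τ.D) (hC : τ.D ≤ τ.C) :
    Schedulable τ (floorPlusOne τ.gamma) ∧
      speedUniformity (floorPlusOne τ.gamma) = τ.gamma - 1 ∧
      totalCapacity (floorPlusOne τ.gamma) = τ.gamma ∧
      responseBound τ (floorPlusOne τ.gamma) = τ.D := by
  have hDL : 0 < τ.D - τ.L := sub_pos.2 hL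
  have hγ : 1 ≤ τ.gamma := (one_le_div hDL).2 (by linarith)
  have hmul : τ.gamma * (τ.D - τ.L) = τ.C - τ.L := div_mul_cancel₀ _ hDL.ne'
  have hbal : τ.C + (τ.gamma - 1) * τ.L = τ.gamma * τ.D := by linarith
  refine ⟨(balancedLoads_floorPlusOne τ hγ hbal.le).schedulable, speedUniformity_floorPlusOne hγ,
    totalCapacity_floorPlusOne _, ?_⟩
  rw [responseBound, speedUniformity_floorPlusOne hγ, totalCapacity_floorPlusOne, hbal]
  exact mul_div_cancel_left₀ _ (by linarith)
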